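/- Let $X$ be a real Banach space, $T>0$, and let $\varphi:X\to X$ be a homeomorphism with $\varphi(0)=0$ whose inverse $\varphi^{-1}$ is Lipschitz with constant $k$. Let $f:[0,T]\times X\times X\to X$ be completely continuous, that is, continuous and mapping bounded sets to relatively compact sets, and suppose that there are numbers $c_0,c_1\ge 0$ such that $$\|f(t,x,y)\|\le c_0+c_1\|y\|\qquad\text{for all }(t,x,y)\in[0,T]\times X\times X.$$ Then the boundary value problem $$(\varphi(u'))'=f(t,u,u'),\qquad u(T)=0=u'(0)$$ has at least one solution, that is, a function $u:[0,T]\to X$ of class $C^1$ such that $t\mapsto\varphi(u'(t))$ is continuously differentiable on $[0,T]$, $u(T)=0=u'(0)$, and $(\varphi(u'(t)))'=f(t,u(t),u'(t))$ for all $t\in[0,T]$. -/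

import Mathlib

open Set

/-- A map `g` is completely continuous on `D` if it is continuous on `D` and maps every bounded
subset of `D` to a relatively compact set. -/
def CompletelyContinuousOn {E F : Type*} [PseudoMetricSpace E] [TopologicalSpace F]
    (g : E → F) (D : Set E) : Prop :=
  ContinuousOn g D ∧ ∀ B : Set E, B ⊆ D → Bornology.IsBounded B → IsCompact (closure (g '' B))

/-- `u` (only its values on `[0, T]` matter) is a solution of `(φ(u'))' = f(t, u, u')`,
`u(T) = 0 = u'(0)`: it is of class `C¹` on `[0, T]`, the function `t ↦ φ(u'(t))` is of class `C¹`
on `[0, T]`, and the equation holds at every point of `[0, T]`. Derivatives are relative to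
`[0, T]`, hence one-sided at the end points. -/
structure IsBVPSolution {X : Type*} [NormedAddCommGroup X] [NormedSpace ℝ X]
    (T : ℝ) (φ : X → X) (f : ℝ → X → X → X) (u : ℝ → X) : Prop where
  contDiffOn : ContDiffOn ℝ 1 u (Icc 0 T)
  contDiffOn_comp : ContDiffOn ℝ 1 (fun t => φ (derivWithin u (Icc 0 T) t)) (Icc 0 T)
  equation : ∀ t ∈ Icc 0 T,
    derivWithin (fun s => φ (derivWithin u (Icc 0 T) s)) (Icc 0 T) t
      = f t (u t) (derivWithin u (Icc 0 T) t)
  value_right : u T = 0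
  deriv_left : derivWithin u (Icc 0 T) 0 = 0

/-! Put v = u'. Solutions correspond to fixed points of G v (t) = φ⁻¹(∫₀ᵗ f(τ, u, v) dτ), where u is
the primitive of v vanishing at T, and Schauder's theorem applies to G on C([0,T], X). Since φ⁻¹ is
k-Lipschitz and fixes 0, ‖G v (t)‖ ≤ k ∫₀ᵗ (c₀ + c₁‖v‖). A bound a·exp(bt) with b > k c₁ is
therefore preserved, with no smallness of T, k or c₁ (`exists_exp_supersolution`). On this set the
values of f lie in a compact set, hence so do their primitives, and the functions G v are
equi-Lipschitz, so Arzelà–Ascoli gives a compact range. Schauder's theorem is reduced to Brouwer's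
by ε-nets. Brouwer's follows from the absence of C¹ retractions onto a sphere, by a volume argument:
x + t(r x - x) permutes the ball for small t, and its Jacobian is polynomial in t, yet the Jacobian
at t = 1 is zero. -/

/-! ### Brouwer's fixed point theorem. -/

open Polynomial in
/-- The function `t ↦ det (1 + t • A)` is polynomial of degree at most the dimension. -/
theorem exists_polynomial_eval_eq_det_one_add_smul {E : Type*} [NormedAddCommGroup E]
    [NormedSpace ℝ E] [FiniteDimensional ℝ E] (A : E →L[ℝ] E) :
    ∃ P : ℝ[X], P.natDegree ≤ Module.finrank ℝ E ∧ ∀ t : ℝ, P.eval t = (1 + t • A).det := by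
  let b := Module.finBasis ℝ E
  let M := LinearMap.toMatrix b b (A : E →ₗ[ℝ] E)
  refine ⟨Matrix.det ((X : ℝ[X]) • M.map C + (1 : Matrix _ _ ℝ).map C), ?_, fun t => ?_⟩
  · simpa using Polynomial.natDegree_det_X_add_C_le M 1
  · have h1 : (1 + t • A).det = LinearMap.det ((1 : E →ₗ[ℝ] E) + t • (A : E →ₗ[ℝ] E)) := rfl
    rw [h1, ← LinearMap.det_toMatrix b, ← Polynomial.coe_evalRingHom, RingHom.map_det]
    congr 1
    have h2 : LinearMap.toMatrix b b ((1 : E →ₗ[ℝ] E) + t • (A : E →ₗ[ℝ] E)) = 1 + t • M := by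
      rw [map_add, map_smul, LinearMap.toMatrix_one]
    rw [h2]
    ext i j
    by_cases hij : i = j
    · subst hij; simp; ring
    · simp [hij]
      ring

open Polynomial in
/-- Extrapolation to `1` of polynomials of bounded degree from nodes close to `0`. -/
theorem exists_extrapolation (n : ℕ) {δ : ℝ} (hδ : 0 < δ) :
    ∃ t w : Fin (n + 1) → ℝ, (∀ i, 0 < t i ∧ t i < δ) ∧ ∑ i, w i = 1 ∧
      ∀ P : ℝ[X], P.natDegree ≤ n → P.eval 1 = ∑ i, w i * P.eval (t i) := by
  -- The shift by 2 keeps even the node `i = 0` strictly below δ.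
  let t : Fin (n + 1) → ℝ := fun i => δ / (i + 2)
  have hinj : Set.InjOn t (Finset.univ : Finset (Fin (n + 1))) := by
    intro i _ j _ h
    have h' : δ / ((i : ℝ) + 2) = δ / ((j : ℝ) + 2) := h
    rw [div_eq_div_iff (by positivity) (by positivity)] at h'
    have := mul_left_cancel₀ hδ.ne' h'
    have h2 : (i : ℝ) = j := by linarith
    exact Fin.ext (by exact_mod_cast h2)
  refine ⟨t, fun i => (Lagrange.basis Finset.univ t i).eval 1, fun i => ⟨?_, ?_⟩, ?_, ?_⟩
  · positivity
  · exact div_lt_self hδ (by have : (0 : ℝ) ≤ (i : ℕ) := by positivity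
                             linarith)
  · rw [← Polynomial.eval_finsetSum, Lagrange.sum_basis hinj ⟨0, Finset.mem_univ _⟩]
    simp
  · intro P hP
    have hdeg : P.degree < (Finset.univ : Finset (Fin (n + 1))).card := by
      refine lt_of_le_of_lt (Polynomial.degree_le_of_natDegree_le hP) ?_
      simp only [Finset.card_univ, Fintype.card_fin]
      exact_mod_cast Nat.lt_succ_self n
    conv_lhs => rw [Lagrange.eq_interpolate hinj hdeg]
    rw [Lagrange.interpolate_apply, Polynomial.eval_finsetSum]
    simp [mul_comm]

/-- A Lipschitz map on a closed ball vanishing on the sphere extends by zero to a Lipschitz map. -/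
theorem LipschitzOnWith.indicator_closedBall {E F : Type*} [NormedAddCommGroup E] [NormedSpace ℝ E]
    [NormedAddCommGroup F] {R : ℝ} {L : NNReal} {p : E → F}
    (hp : LipschitzOnWith L p (Metric.closedBall 0 R)) (h0 : ∀ x, ‖x‖ = R → p x = 0) :
    LipschitzWith L ((Metric.closedBall (0 : E) R).indicator p) := by
  classical
  -- The segment from x to y crosses the sphere, where p vanishes, at a point no farther from x than
  -- y is.
  have key : ∀ x y : E, x ∈ Metric.closedBall (0 : E) R → y ∉ Metric.closedBall (0 : E) R →
      dist (p x) 0 ≤ L * dist x y := by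
    intro x y hx hy
    have hc : ContinuousOn (fun s : ℝ => ‖AffineMap.lineMap x y s‖) (Icc 0 1) := by
      apply Continuous.continuousOn
      exact AffineMap.lineMap_continuous.norm
    obtain ⟨s, hs, hsR⟩ : R ∈ (fun s : ℝ => ‖AffineMap.lineMap (k := ℝ) x y s‖) '' Icc 0 1 := by
      apply intermediate_value_Icc zero_le_one hc
      simp only [Metric.mem_closedBall, dist_zero_right, not_le] at hx hy
      simp [hx, hy.le]
    simp only at hsR
    rw [← h0 _ hsR]
    refine (hp.dist_le_mul x hx _ (by simp [hsR])).trans ?_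
    gcongr
    rw [dist_left_lineMap, Real.norm_of_nonneg hs.1]
    exact mul_le_of_le_one_left dist_nonneg hs.2
  refine LipschitzWith.of_dist_le_mul fun x y => ?_
  by_cases hx : x ∈ Metric.closedBall (0 : E) R <;> by_cases hy : y ∈ Metric.closedBall (0 : E) R
  · simpa [indicator_of_mem hx, indicator_of_mem hy] using hp.dist_le_mul x hx y hy
  · simpa only [indicator_of_mem hx, indicator_of_notMem hy] using key x y hx hy
  · rw [dist_comm, dist_comm x]
    simpa only [indicator_of_mem hy, indicator_of_notMem hx] using key y x hy hx
  · simp only [indicator_of_notMem hy, indicator_of_notMem hx, dist_self]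
    positivity

/-- For surjectivity, extend p by zero to q and solve z = y - t q(z) by contraction on the whole
space; a solution outside the ball would equal y, which is inside. -/
theorem bijOn_closedBall_add_smul {E : Type*} [NormedAddCommGroup E] [NormedSpace ℝ E]
    [CompleteSpace E] {R : ℝ} {L : NNReal} {p : E → E}
    (hp : LipschitzOnWith L p (Metric.closedBall 0 R)) (h0 : ∀ x, ‖x‖ = R → p x = 0)
    (hmaps : ∀ x ∈ Metric.closedBall (0 : E) R, x + p x ∈ Metric.closedBall (0 : E) R)
    {t : ℝ} (ht0 : 0 ≤ t) (ht1 : t ≤ 1) (htL : t * L < 1) :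
    BijOn (fun x => x + t • p x) (Metric.closedBall 0 R) (Metric.closedBall 0 R) := by
  classical
  refine ⟨fun x hx => ?_, fun x hx y hy hxy => ?_, fun y hy => ?_⟩
  · have := (convex_closedBall (0 : E) R) hx (hmaps x hx) (sub_nonneg.2 ht1) ht0 (by ring)
    convert this using 1
    module
  · have h1 : x - y = t • (p y - p x) := by
      have : x + t • p x = y + t • p y := hxy
      rw [smul_sub, sub_eq_sub_iff_add_eq_add, add_comm (t • p y), this]
    have h2 : dist x y ≤ (t * L) * dist x y := by
      conv_lhs => rw [dist_eq_norm, h1, norm_smul, Real.norm_of_nonneg ht0, ← dist_eq_norm]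
      rw [mul_assoc, dist_comm x y]
      gcongr
      exact hp.dist_le_mul y hy x hx
    by_contra hne
    have := dist_pos.2 hne
    nlinarith
  · have hq := hp.indicator_closedBall h0
    set q := (Metric.closedBall (0 : E) R).indicator p with hqdef
    have hlip : LipschitzWith (t.toNNReal * L) (fun x => y - t • q x) := by
      refine LipschitzWith.of_dist_le_mul fun a b => ?_
      rw [dist_sub_left, dist_smul₀, Real.norm_of_nonneg ht0, NNReal.coe_mul,
        Real.coe_toNNReal _ ht0, mul_assoc]
      gcongr
      exact hq.dist_le_mul a b
    have hcon : ContractingWith (t.toNNReal * L) (fun x => y - t • q x) := by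
      refine ⟨?_, hlip⟩
      rw [← NNReal.coe_lt_coe]
      simpa [Real.coe_toNNReal _ ht0] using htL
    have hfix : y - t • q (hcon.fixedPoint _) = hcon.fixedPoint _ := hcon.fixedPoint_isFixedPt
    set z := hcon.fixedPoint _ with hz
    have hzR : z ∈ Metric.closedBall (0 : E) R := by
      by_contra hn
      rw [hqdef, indicator_of_notMem hn, smul_zero, sub_zero] at hfix
      exact hn (hfix ▸ hy)
    refine ⟨z, hzR, ?_⟩
    rw [hqdef, indicator_of_mem hzR] at hfix
    simp only
    nth_rewrite 1 [← hfix]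
    abel

open MeasureTheory Filter Topology in
/-- There is no `C¹` retraction of a ball onto its boundary sphere. -/
theorem not_exists_contDiff_retraction_sphere {E : Type*} [NormedAddCommGroup E]
    [InnerProductSpace ℝ E] [FiniteDimensional ℝ E] {R : ℝ} (hR : 0 < R) {r : E → E}
    (hr : ContDiff ℝ 1 r) (hnorm : ∀ x, ‖r x‖ = R) (hid : ∀ x, ‖x‖ = R → r x = x) : False := by
  borelize E
  let p : E → E := fun x => r x - x
  have hp : ContDiff ℝ 1 p := hr.sub contDiff_id
  have hpd : ∀ x, HasFDerivAt p (fderiv ℝ p x) x := fun x =>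
    (hp.differentiable one_ne_zero x).hasFDerivAt
  obtain ⟨L, hL⟩ := hp.contDiffOn.exists_lipschitzOnWith one_ne_zero
    (convex_closedBall (0 : E) R) (isCompact_closedBall 0 R)
  have hcont : Continuous fun z : ℝ × E => (1 + z.1 • fderiv ℝ p z.2).det := by
    refine ContinuousLinearMap.continuous_det.comp ?_
    have := hp.continuous_fderiv one_ne_zero
    fun_prop
  have hpos : ∀ᶠ t : ℝ in 𝓝 0, ∀ x ∈ Metric.closedBall (0 : E) R,
      0 < (1 + t • fderiv ℝ p x).det := by
    refine (isCompact_closedBall (0 : E) R).eventually_forall_of_forall_eventually fun y _ => ?_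
    refine hcont.continuousAt.eventually (lt_mem_nhds ?_)
    simp [ContinuousLinearMap.det]
  have hsmall : ∀ᶠ t : ℝ in 𝓝 0, t ≤ 1 ∧ t * L < 1 := by
    refine (eventually_le_nhds zero_lt_one).and ?_
    have : Tendsto (fun t : ℝ => t * L) (𝓝 0) (𝓝 (0 * L)) := by
      exact (continuous_id.mul continuous_const).tendsto 0
    rw [zero_mul] at this
    exact this.eventually (gt_mem_nhds zero_lt_one)
  obtain ⟨δ, hδ, hball⟩ := Metric.eventually_nhds_iff.1 (hpos.and hsmall)
  have hvol : ∀ t : ℝ, 0 < t → t < δ →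
      ∫ x in Metric.closedBall (0 : E) R, (1 + t • fderiv ℝ p x).det
        = ∫ x in Metric.closedBall (0 : E) R, (1 : ℝ) := by
    intro t ht htδ
    obtain ⟨hpos', ht1, htL⟩ := hball (by simpa [abs_of_pos ht] using htδ : dist t 0 < δ)
    have hbij := bijOn_closedBall_add_smul hL (fun x hx => by simp [p, hid x hx])
      (fun x _ => by simp [p, hnorm x]) ht.le ht1 htL
    have := integral_image_eq_integral_abs_det_fderiv_smul (volume : Measure E)
      (Metric.isClosed_closedBall (x := (0 : E)) (ε := R)).measurableSet
      (f := fun x => x + t • p x) (f' := fun x => 1 + t • fderiv ℝ p x)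
      (fun x _ => ((hasFDerivAt_id x).add ((hpd x).const_smul t)).hasFDerivWithinAt)
      hbij.injOn (fun _ => (1 : ℝ))
    rw [hbij.image_eq] at this
    rw [this]
    refine setIntegral_congr_fun Metric.isClosed_closedBall.measurableSet fun x hx => ?_
    simp [abs_of_pos (hpos' x hx)]
  -- Differentiating ‖r‖² = R² shows that r x is orthogonal to the range of Dr(x), so Dr(x) is not
  -- onto.
  have hdet : ∀ x, (1 + (1 : ℝ) • fderiv ℝ p x).det = 0 := by
    intro x
    by_contra hne
    have hrd : HasFDerivAt r (1 + (1 : ℝ) • fderiv ℝ p x) x := by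
      have := (hasFDerivAt_id x).add (hpd x)
      rw [one_smul]
      refine this.congr_of_eventuallyEq (Eventually.of_forall fun y => ?_)
      simp [p]
    have hconst : HasFDerivAt (fun y => inner ℝ (r y) (r y)) (0 : E →L[ℝ] ℝ) x := by
      have : (fun y => inner ℝ (r y) (r y)) = fun _ => R ^ 2 := by
        ext y; rw [real_inner_self_eq_norm_sq, hnorm]
      rw [this]
      exact hasFDerivAt_const _ _
    have hin := (hrd.inner ℝ hrd).unique hconst
    have hsurj := (LinearMap.equivOfDetNeZero _ hne).surjective
    obtain ⟨v, hv⟩ := hsurj (r x)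
    have hv' : (1 + (1 : ℝ) • fderiv ℝ p x) v = r x := hv
    have h2 := congrArg (fun A : E →L[ℝ] ℝ => A v) hin
    simp only [ContinuousLinearMap.comp_apply, fderivInnerCLM_apply, ContinuousLinearMap.prod_apply,
      hv', real_inner_self_eq_norm_sq, hnorm, zero_apply] at h2
    nlinarith
  obtain ⟨t, w, ht, hw, hext⟩ := exists_extrapolation (Module.finrank ℝ E) hδ
  have hpoint : ∀ x, ∑ i, w i * (1 + t i • fderiv ℝ p x).det = 0 := by
    intro x
    obtain ⟨P, hP, hPe⟩ := exists_polynomial_eval_eq_det_one_add_smul (fderiv ℝ p x)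
    have := hext P hP
    simp only [hPe, hdet] at this
    exact this.symm
  -- This sum is also the volume of the ball, as each integral is that volume and the weights sum to
  -- 1.
  have hint : ∑ i, w i * ∫ x in Metric.closedBall (0 : E) R, (1 + t i • fderiv ℝ p x).det = 0 := by
    simp_rw [← integral_const_mul]
    rw [← integral_finsetSum]
    · simp [hpoint]
    · intro i _
      refine ContinuousOn.integrableOn_compact (isCompact_closedBall 0 R) ?_
      exact (continuous_const.mul (hcont.comp (Continuous.prodMk_right (t i)))).continuousOn
  have : ∑ i, w i * ∫ x in Metric.closedBall (0 : E) R, (1 + t i • fderiv ℝ p x).det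
      = ∫ x in Metric.closedBall (0 : E) R, (1 : ℝ) := by
    rw [Finset.sum_congr rfl fun i _ => by rw [hvol (t i) (ht i).1 (ht i).2], ← Finset.sum_mul, hw,
      one_mul]
  rw [this] at hint
  have hv : 0 < volume.real (Metric.closedBall (0 : E) R) :=
    ENNReal.toReal_pos (Metric.measure_closedBall_pos volume 0 hR).ne'
      measure_closedBall_lt_top.ne
  simp at hint
  exact hv.ne' hint

/-- Without fixed points, x - g x rescaled to length R would be a C¹ retraction, since g vanishes on
the sphere. -/
theorem exists_fixedPoint_of_contDiff {E : Type*} [NormedAddCommGroup E]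
    [InnerProductSpace ℝ E] [FiniteDimensional ℝ E] {R : ℝ} (hR : 0 < R) {g : E → E}
    (hg : ContDiff ℝ 1 g) (h0 : ∀ x, R ≤ ‖x‖ → g x = 0) : ∃ x, g x = x := by
  by_contra! hne
  have hh : ∀ x, x - g x ≠ 0 := fun x => sub_ne_zero.2 (hne x).symm
  have hsm : ContDiff ℝ 1 fun x => x - g x := contDiff_id.sub hg
  refine not_exists_contDiff_retraction_sphere hR
    (r := fun x => (R * ‖x - g x‖⁻¹) • (x - g x)) ?_ (fun x => ?_) (fun x hx => ?_)
  · exact (contDiff_const.mul ((hsm.norm ℝ hh).inv fun x => norm_ne_zero_iff.2 (hh x))).smul hsm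
  · rw [norm_smul, norm_mul, norm_inv, norm_norm, mul_assoc,
      inv_mul_cancel₀ (norm_ne_zero_iff.2 (hh x)), mul_one, Real.norm_of_nonneg hR.le]
  · simp [h0 x hx.ge, hx, hR.ne']

/-- **Brouwer's fixed point theorem** for bounded continuous self-maps of a Euclidean space. -/
theorem exists_fixedPoint_of_continuous_of_bounded {E : Type*} [NormedAddCommGroup E]
    [InnerProductSpace ℝ E] [FiniteDimensional ℝ E] {M : ℝ} {g : E → E}
    (hg : Continuous g) (hM : ∀ x, ‖g x‖ ≤ M) : ∃ x, g x = x := by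
  have hM0 : 0 ≤ M := (norm_nonneg _).trans (hM 0)
  let χ : E → ℝ := fun x => max 0 (min 1 (M + 1 - ‖x‖))
  have hχ : Continuous χ := by fun_prop
  have hχ0 : ∀ x, 0 ≤ χ x := fun x => le_max_left _ _
  have hχ1 : ∀ x, χ x ≤ 1 := fun x => max_le zero_le_one (min_le_left _ _)
  have hχM : ∀ x, ‖x‖ ≤ M → χ x = 1 := fun x hx => by
    simp only [χ]
    rw [min_eq_left (by linarith), max_eq_right zero_le_one]
  have hχR : ∀ x, M + 1 ≤ ‖x‖ → χ x = 0 := fun x hx => by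
    simp only [χ]
    exact max_eq_left ((min_le_right _ _).trans (by linarith))
  by_contra! hne
  have hne' : ∀ x, χ x • g x ≠ x := by
    intro x hx
    have : ‖x‖ ≤ M := by
      rw [← hx, norm_smul, Real.norm_of_nonneg (hχ0 x)]
      exact (mul_le_of_le_one_left (norm_nonneg _) (hχ1 x)).trans (hM x)
    rw [hχM x this, one_smul] at hx
    exact hne x hx
  -- The tolerance is the displacement itself, so a fixed point of s would violate the strict
  -- estimate.
  obtain ⟨s, hs, hdist, hsupp⟩ := Continuous.exists_contDiff_approx (f := fun x => χ x • g x)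
    (ε := fun x => dist x (χ x • g x)) 1 (hχ.smul hg) (continuous_id.dist (hχ.smul hg))
    (fun x => dist_pos.2 (hne' x).symm)
  obtain ⟨x, hx⟩ := exists_fixedPoint_of_contDiff (R := M + 1) (by linarith) hs fun x hx => by
    by_contra hsx
    exact hsupp hsx (by simp [hχR x hx])
  have := hdist x
  rw [hx] at this
  exact lt_irrefl _ this

/-- The standard simplex is a retract of the ambient space. -/
theorem exists_continuous_retraction_stdSimplex (ι : Type*) [Fintype ι] [Nonempty ι] :
    ∃ ρ : (ι → ℝ) → ι → ℝ, Continuous ρ ∧ (∀ x, ρ x ∈ stdSimplex ℝ ι) ∧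
      ∀ x ∈ stdSimplex ℝ ι, ρ x = x := by
  let S : (ι → ℝ) → ℝ := fun x => ∑ i, max (x i) 0
  have hS : Continuous S := by fun_prop
  have hmax : ∀ x, 0 < max (S x) 1 := fun x => lt_max_of_lt_right one_pos
  have hcard : (0 : ℝ) < Fintype.card ι := by exact_mod_cast Fintype.card_pos
  -- Missing mass is shared equally among the coordinates; excess mass is divided out.
  refine ⟨fun x i => (max (x i) 0 + max (1 - S x) 0 / Fintype.card ι) / max (S x) 1, ?_, ?_, ?_⟩
  · refine continuous_pi fun i => Continuous.div (by fun_prop) (by fun_prop) fun x => (hmax x).ne'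
  · refine fun x => ⟨fun i => ?_, ?_⟩
    · have := hmax x
      positivity
    · rw [← Finset.sum_div, div_eq_one_iff_eq (hmax x).ne', Finset.sum_add_distrib,
        Finset.sum_const, Finset.card_univ, nsmul_eq_mul, mul_div_cancel₀ _ hcard.ne']
      change S x + _ = _
      rcases le_total (S x) 1 with h | h
      · rw [max_eq_left (by linarith), max_eq_right h]; ring
      · rw [max_eq_right (by linarith), max_eq_left h]; ring
  · intro x hx
    have hxi : ∀ i, max (x i) 0 = x i := fun i => max_eq_left (hx.1 i)
    have hS1 : S x = 1 := by simp only [S, hxi]; exact hx.2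
    ext i
    simp [hxi, hS1]

/-- **Brouwer's fixed point theorem** for the standard simplex. -/
theorem exists_fixedPoint_stdSimplex {ι : Type*} [Fintype ι] [Nonempty ι] {g : (ι → ℝ) → ι → ℝ}
    (hg : ContinuousOn g (stdSimplex ℝ ι)) (hmaps : MapsTo g (stdSimplex ℝ ι) (stdSimplex ℝ ι)) :
    ∃ x ∈ stdSimplex ℝ ι, g x = x := by
  obtain ⟨ρ, hρ, hρm, hρid⟩ := exists_continuous_retraction_stdSimplex ι
  let G : EuclideanSpace ℝ ι → EuclideanSpace ℝ ι := fun x => WithLp.toLp 2 (g (ρ (WithLp.ofLp x)))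
  have hG : Continuous G := by
    refine (PiLp.continuous_toLp 2 _).comp (hg.comp_continuous ?_ fun x => hρm _)
    exact hρ.comp (PiLp.continuous_ofLp 2 _)
  obtain ⟨M, hM⟩ := ((isCompact_stdSimplex ℝ ι).image
    (PiLp.continuous_toLp 2 (fun _ : ι => ℝ))).isBounded.exists_norm_le
  obtain ⟨x, hx⟩ := exists_fixedPoint_of_continuous_of_bounded hG (M := M) fun x =>
    hM _ (mem_image_of_mem _ (hmaps (hρm _)))
  have hx' : g (ρ (WithLp.ofLp x)) = WithLp.ofLp x := congrArg WithLp.ofLp hx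
  have hmem : WithLp.ofLp x ∈ stdSimplex ℝ ι := hx' ▸ hmaps (hρm _)
  exact ⟨_, hmem, by rwa [hρid _ hmem] at hx'⟩

/-! ### Schauder's fixed point theorem. -/

/-- Schauder projection: a partition of unity on an ε-net of A turns K into a self-map of a simplex.
At a fixed point only net points within ε of K x carry weight. -/
theorem exists_dist_lt_of_mapsTo_compact {E : Type*} [NormedAddCommGroup E] [NormedSpace ℝ E]
    {C A : Set E} (hCconv : Convex ℝ C) (hCne : C.Nonempty) (hA : IsCompact A) (hAC : A ⊆ C)
    {K : E → E} (hK : ContinuousOn K C) (hKA : MapsTo K C A) {ε : ℝ} (hε : 0 < ε) :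
    ∃ x ∈ C, dist (K x) x ≤ ε := by
  obtain ⟨t, htA, htfin, hcov⟩ := hA.finite_cover_balls hε
  have := htfin.fintype
  have hnear : ∀ z ∈ A, ∃ y : t, dist z y < ε := fun z hz => by
    obtain ⟨y, hy, hzy⟩ := mem_iUnion₂.1 (hcov hz)
    exact ⟨⟨y, hy⟩, hzy⟩
  obtain ⟨c, hc⟩ := hCne
  have : Nonempty t := let ⟨y, _⟩ := hnear _ (hKA hc); ⟨y⟩
  let m : t → E → ℝ := fun y z => max 0 (ε - dist z y)
  have hm : ∀ y, Continuous (m y) := fun y => by fun_prop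
  have hm0 : ∀ y z, 0 ≤ m y z := fun y z => le_max_left _ _
  let S : E → ℝ := fun z => ∑ y, m y z
  have hS : Continuous S := by fun_prop
  have hSpos : ∀ z ∈ A, 0 < S z := fun z hz => by
    obtain ⟨y, hy⟩ := hnear z hz
    exact Finset.sum_pos' (fun _ _ => hm0 _ _)
      ⟨y, Finset.mem_univ _, lt_max_of_lt_right (sub_pos.2 hy)⟩
  let b : (t → ℝ) → E := fun x => ∑ y, x y • (y : E)
  have hb : Continuous b := by fun_prop
  have hbC : ∀ x ∈ stdSimplex ℝ t, b x ∈ C := fun x hx =>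
    hCconv.sum_mem (fun y _ => hx.1 y) hx.2 fun y _ => hAC (htA y.2)
  obtain ⟨x, hx, hfix⟩ := exists_fixedPoint_stdSimplex (ι := t)
    (g := fun x y => m y (K (b x)) / S (K (b x)))
    (by
      have hKb : ContinuousOn (fun x => K (b x)) (stdSimplex ℝ t) :=
        hK.comp hb.continuousOn hbC
      refine continuousOn_pi.2 fun y => ContinuousOn.div ((hm y).comp_continuousOn hKb)
        (hS.comp_continuousOn hKb) fun x hx => (hSpos _ (hKA (hbC x hx))).ne')
    (fun x hx => ⟨fun y => div_nonneg (hm0 _ _) (hSpos _ (hKA (hbC x hx))).le, by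
      rw [← Finset.sum_div]
      exact div_self (hSpos _ (hKA (hbC x hx))).ne'⟩)
  refine ⟨b x, hbC x hx, ?_⟩
  have hle : ∀ y, x y * dist (K (b x)) y ≤ x y * ε := by
    intro y
    rcases lt_or_ge (dist (K (b x)) y) ε with h | h
    · exact mul_le_mul_of_nonneg_left h.le (hx.1 y)
    · have h0 : x y = 0 := by
        rw [← congrFun hfix y]
        simp only [m]
        rw [max_eq_left (by linarith), zero_div]
      simp [h0]
  have heq : K (b x) - b x = ∑ y, x y • (K (b x) - y) := by
    simp_rw [smul_sub]
    rw [Finset.sum_sub_distrib, ← Finset.sum_smul, hx.2, one_smul]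
  calc dist (K (b x)) (b x) = ‖∑ y, x y • (K (b x) - y)‖ := by rw [dist_eq_norm, heq]
    _ ≤ ∑ y, x y * dist (K (b x)) y := by
      refine (norm_sum_le _ _).trans (Finset.sum_le_sum fun y _ => ?_)
      rw [norm_smul, Real.norm_of_nonneg (hx.1 y), dist_eq_norm]
    _ ≤ ∑ y, x y * ε := Finset.sum_le_sum fun y _ => hle y
    _ = ε := by rw [← Finset.sum_mul, hx.2, one_mul]

open Filter Topology in
/-- **Schauder's fixed point theorem**. -/
theorem exists_fixedPoint_of_mapsTo_compact {E : Type*} [NormedAddCommGroup E] [NormedSpace ℝ E]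
    {C A : Set E} (hCconv : Convex ℝ C) (hCclosed : IsClosed C) (hCne : C.Nonempty)
    (hA : IsCompact A) {K : E → E} (hK : ContinuousOn K C) (hKC : MapsTo K C C)
    (hKA : MapsTo K C A) : ∃ x ∈ C, K x = x := by
  have hAC : IsCompact (A ∩ C) := hA.inter_right hCclosed
  choose x hxC hx using fun n : ℕ => exists_dist_lt_of_mapsTo_compact hCconv hCne hAC
    inter_subset_right hK (fun _ h => ⟨hKA h, hKC h⟩) (Nat.one_div_pos_of_nat (α := ℝ) (n := n))
  obtain ⟨a, ha, σ, hσ, hlim⟩ := hAC.tendsto_subseq fun n => ⟨hKA (hxC n), hKC (hxC n)⟩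
  have hdist : Tendsto (fun n => dist (K (x (σ n))) (x (σ n))) atTop (𝓝 0) :=
    squeeze_zero (fun _ => dist_nonneg) (fun n => hx (σ n))
      (tendsto_one_div_add_atTop_nhds_zero_nat.comp hσ.tendsto_atTop)
  have hxa : Tendsto (fun n => x (σ n)) atTop (𝓝 a) := (tendsto_iff_of_dist hdist).1 hlim
  have hKa : Tendsto (fun n => K (x (σ n))) atTop (𝓝 (K a)) :=
    (hK a ha.2).tendsto.comp
      (tendsto_nhdsWithin_iff.2 ⟨hxa, Eventually.of_forall fun n => hxC (σ n)⟩)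
  exact ⟨a, ha.2, tendsto_nhds_unique hKa hlim⟩

/-! ### Compactness criteria. -/

/-- A set of equi-Lipschitz maps with values in a compact set is relatively compact. -/
theorem exists_isCompact_superset_lipschitz {α β : Type*} [PseudoMetricSpace α] [CompactSpace α]
    [MetricSpace β] {s : Set β} (hs : IsCompact s) (L : NNReal) :
    ∃ A : Set C(α, β), IsCompact A ∧
      ∀ w : C(α, β), (∀ t, w t ∈ s) → LipschitzWith L w → w ∈ A := by
  let e := ContinuousMap.isometryEquivBoundedOfCompact α β
  let B : Set C(α, β) := {w | (∀ t, w t ∈ s) ∧ LipschitzWith L w}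
  have hB : IsCompact (closure (e '' B)) := by
    refine BoundedContinuousFunction.arzela_ascoli s hs _ ?_ ?_
    · rintro _ x ⟨w, hw, rfl⟩
      exact hw.1 x
    · refine (LipschitzWith.uniformEquicontinuous _ L ?_).equicontinuous
      rintro ⟨_, w, hw, rfl⟩
      exact hw.2
  refine ⟨e.symm '' closure (e '' B), hB.image e.symm.continuous, fun w h1 h2 => ?_⟩
  exact ⟨e w, subset_closure ⟨w, ⟨h1, h2⟩, rfl⟩, e.symm_apply_apply w⟩

open MeasureTheory in
/-- Primitives of functions with values in a fixed compact set take values in a compact set. -/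
theorem exists_isCompact_forall_integral_mem {X : Type*} [NormedAddCommGroup X] [NormedSpace ℝ X]
    [CompleteSpace X] {Q : Set X} (hQ : IsCompact Q) (T : ℝ) :
    ∃ S : Set X, IsCompact S ∧ ∀ g : ℝ → X, Continuous g → (∀ t, g t ∈ Q) →
      ∀ t ∈ Icc 0 T, ∫ τ in (0 : ℝ)..t, g τ ∈ S := by
  have hH : IsCompact (closure (convexHull ℝ Q)) :=
    (hQ.totallyBounded.convexHull.closure).isCompact_of_isClosed isClosed_closure
  refine ⟨(fun p : ℝ × X => p.1 • p.2) '' (Icc 0 T ×ˢ closure (convexHull ℝ Q)),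
    (isCompact_Icc.prod hH).image continuous_smul, fun g hg hgQ t ht => ?_⟩
  have hgH : ∀ τ, g τ ∈ closure (convexHull ℝ Q) := fun τ =>
    subset_closure (subset_convexHull ℝ Q (hgQ τ))
  -- For t > 0 the integral is t times an average, which lies in the closed convex hull. At t = 0
  -- the average defaults to 0, possibly outside the hull.
  rcases ht.1.eq_or_lt with rfl | h0
  · exact ⟨(0, g 0), ⟨ht, hgH 0⟩, by simp⟩
  · refine ⟨(t, ⨍ τ in (0 : ℝ)..t, g τ), ⟨ht, ?_⟩, ?_⟩
    · rw [uIoc_of_le h0.le]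
      refine (convex_convexHull ℝ Q).closure.set_average_mem isClosed_closure ?_ ?_
        (Filter.Eventually.of_forall hgH) (hg.integrableOn_Ioc)
      · simpa using h0
      · simp
    · simp only [interval_average_eq, sub_zero]
      rw [smul_inv_smul₀ h0.ne']

/-! ### The integral operator and its fixed points. -/

/-- The primitive, vanishing at `T`, of the extension of `v` by constants to the real line. -/
noncomputable def primitiveFromRight {X : Type*} [NormedAddCommGroup X] [NormedSpace ℝ X] {T : ℝ}
    (hT : 0 ≤ T) (v : C(Icc (0 : ℝ) T, X)) (s : ℝ) : X :=
  ∫ τ in T..s, v (projIcc 0 T hT τ)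

/-- The superposition operator `v ↦ f(·, u, v)`, where `u' = v` and `u(T) = 0`. -/
noncomputable def superposition {X : Type*} [NormedAddCommGroup X] [NormedSpace ℝ X] {T : ℝ}
    (hT : 0 ≤ T) (f : ℝ → X → X → X) (v : C(Icc (0 : ℝ) T, X)) (t : ℝ) : X :=
  f (projIcc 0 T hT t) (primitiveFromRight hT v (projIcc 0 T hT t)) (v (projIcc 0 T hT t))

theorem continuous_extend_uncurry {X : Type*} [TopologicalSpace X] {T : ℝ} (hT : 0 ≤ T) :
    Continuous fun p : C(Icc (0 : ℝ) T, X) × ℝ => p.1 (projIcc 0 T hT p.2) := by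
  have h : Continuous fun p : C(Icc (0 : ℝ) T, X) × ℝ => projIcc 0 T hT p.2 :=
    continuous_projIcc.comp continuous_snd
  exact continuous_eval.comp (continuous_fst.prodMk h)

theorem continuous_primitiveFromRight_uncurry {X : Type*} [NormedAddCommGroup X]
    [NormedSpace ℝ X] {T : ℝ} (hT : 0 ≤ T) :
    Continuous fun p : C(Icc (0 : ℝ) T, X) × ℝ => primitiveFromRight hT p.1 p.2 := by
  refine intervalIntegral.continuous_parametric_intervalIntegral_of_continuous
    (f := fun (p : C(Icc (0 : ℝ) T, X) × ℝ) τ => p.1 (projIcc 0 T hT τ)) ?_ continuous_snd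
  exact (continuous_extend_uncurry hT).comp
    ((continuous_fst.comp continuous_fst).prodMk continuous_snd)

theorem continuous_superposition_uncurry {X : Type*} [NormedAddCommGroup X]
    [NormedSpace ℝ X] {T : ℝ} (hT : 0 ≤ T) {f : ℝ → X → X → X}
    (hf : ContinuousOn (fun p : ℝ × X × X => f p.1 p.2.1 p.2.2) (Icc 0 T ×ˢ univ)) :
    Continuous fun p : C(Icc (0 : ℝ) T, X) × ℝ => superposition hT f p.1 p.2 := by
  have hproj : Continuous fun p : C(Icc (0 : ℝ) T, X) × ℝ => ((projIcc 0 T hT p.2 : Icc 0 T) : ℝ) :=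
    continuous_subtype_val.comp (continuous_projIcc.comp continuous_snd)
  exact hf.comp_continuous (hproj.prodMk
    (((continuous_primitiveFromRight_uncurry hT).comp (continuous_fst.prodMk hproj)).prodMk
      (continuous_extend_uncurry hT))) fun p => ⟨(projIcc 0 T hT p.2).2, mem_univ _⟩

theorem continuous_superposition {X : Type*} [NormedAddCommGroup X]
    [NormedSpace ℝ X] {T : ℝ} (hT : 0 ≤ T) {f : ℝ → X → X → X}
    (hf : ContinuousOn (fun p : ℝ × X × X => f p.1 p.2.1 p.2.2) (Icc 0 T ×ˢ univ))
    (v : C(Icc (0 : ℝ) T, X)) : Continuous (superposition hT f v) :=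
  (continuous_superposition_uncurry hT hf).comp (Continuous.prodMk_right v)

theorem hasDerivAt_primitiveFromRight {X : Type*} [NormedAddCommGroup X] [NormedSpace ℝ X]
    [CompleteSpace X] {T : ℝ} (hT : 0 ≤ T) (v : C(Icc (0 : ℝ) T, X)) (s : ℝ) :
    HasDerivAt (primitiveFromRight hT v) (v (projIcc 0 T hT s)) s :=
  (Continuous.integral_hasStrictDerivAt (f := fun τ => v (projIcc 0 T hT τ))
    (v.continuous.comp continuous_projIcc) T s).hasDerivAt

theorem norm_primitiveFromRight_le {X : Type*} [NormedAddCommGroup X] [NormedSpace ℝ X] {T M : ℝ}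
    (hT : 0 ≤ T) {v : C(Icc (0 : ℝ) T, X)} (hv : ∀ t, ‖v t‖ ≤ M) {s : ℝ} (hs : s ∈ Icc 0 T) :
    ‖primitiveFromRight hT v s‖ ≤ M * T := by
  have hM : 0 ≤ M := (norm_nonneg _).trans (hv ⟨s, hs⟩)
  refine (intervalIntegral.norm_integral_le_of_norm_le_const fun x _ => hv _).trans ?_
  gcongr
  rw [abs_sub_comm, abs_of_nonneg (sub_nonneg.2 hs.2)]
  linarith [hs.1]

/-- The integral operator whose fixed points are the derivatives of the solutions. -/
theorem exists_integralOperator {X : Type*} [NormedAddCommGroup X]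
    [NormedSpace ℝ X] {T : ℝ} (hT : 0 ≤ T) {f : ℝ → X → X → X}
    (hf : ContinuousOn (fun p : ℝ × X × X => f p.1 p.2.1 p.2.2) (Icc 0 T ×ˢ univ))
    {ψ : X → X} (hψ : Continuous ψ) :
    ∃ G : C(Icc (0 : ℝ) T, X) → C(Icc (0 : ℝ) T, X), Continuous G ∧
      ∀ v t, G v t = ψ (∫ τ in (0 : ℝ)..t, superposition hT f v τ) := by
  -- Joint continuity suffices: currying gives continuity into the space of continuous maps.
  have hc : Continuous fun p : C(Icc (0 : ℝ) T, X) × Icc (0 : ℝ) T =>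
      ψ (∫ τ in (0 : ℝ)..p.2, superposition hT f p.1 τ) := by
    refine hψ.comp (intervalIntegral.continuous_parametric_intervalIntegral_of_continuous
      (f := fun (p : C(Icc (0 : ℝ) T, X) × Icc (0 : ℝ) T) τ => superposition hT f p.1 τ) ?_
      (continuous_subtype_val.comp continuous_snd))
    exact (continuous_superposition_uncurry hT hf).comp
      ((continuous_fst.comp continuous_fst).prodMk continuous_snd)
  exact ⟨ContinuousMap.curry ⟨_, hc⟩, ContinuousMap.continuous _, fun v t => rfl⟩

/-- A weight for which the integral operator preserves a ball. -/
theorem exists_exp_supersolution {k c₀ c₁ : ℝ} (hk : 0 ≤ k) (hc₀ : 0 ≤ c₀) (hc₁ : 0 ≤ c₁) {T : ℝ}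
    (hT : 0 ≤ T) :
    ∃ a b : ℝ, 0 ≤ a ∧ 0 < b ∧ ∀ t ∈ Icc 0 T,
      k * ∫ τ in (0 : ℝ)..t, (c₀ + c₁ * (a * Real.exp (b * τ))) ≤ a * Real.exp (b * t) := by
  set b := k * c₁ + 1 with hb
  have hb0 : 0 < b := by positivity
  -- The factor b cancels the 1/b from integrating the exponential.
  refine ⟨b * (k * c₀ * T), b, by positivity, hb0, fun t ht => ?_⟩
  have hint : ∫ τ in (0 : ℝ)..t, (c₀ + c₁ * (b * (k * c₀ * T) * Real.exp (b * τ)))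
      = c₀ * t + c₁ * (k * c₀ * T) * (Real.exp (b * t) - 1) := by
    rw [intervalIntegral.integral_add (by simp) (Continuous.intervalIntegrable (by fun_prop) _ _),
      intervalIntegral.integral_const_mul, intervalIntegral.integral_const_mul,
      intervalIntegral.integral_comp_mul_left _ hb0.ne', integral_exp]
    simp
    field_simp
  have he : 1 ≤ Real.exp (b * t) := Real.one_le_exp (by have := ht.1; positivity)
  have h1 : k * c₀ * t ≤ k * c₀ * T := mul_le_mul_of_nonneg_left ht.2 (by positivity)
  have h2 : 0 ≤ k * c₀ * T := by positivity
  have h3 : 0 ≤ k * c₁ * (k * c₀ * T) := by positivity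
  rw [hint, hb]
  nlinarith [mul_le_mul_of_nonneg_left he h2]

theorem isBVPSolution_primitiveFromRight {X : Type*} [NormedAddCommGroup X] [NormedSpace ℝ X]
    [CompleteSpace X] {T : ℝ} (hT : 0 < T) {φ : X ≃ₜ X} (hφ0 : φ 0 = 0) {f : ℝ → X → X → X}
    (hf : ContinuousOn (fun p : ℝ × X × X => f p.1 p.2.1 p.2.2) (Icc 0 T ×ˢ univ))
    {v : C(Icc (0 : ℝ) T, X)}
    (hv : ∀ t, v t = φ.symm (∫ τ in (0 : ℝ)..t, superposition hT.le f v τ)) :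
    IsBVPSolution T φ f (primitiveFromRight hT.le v) := by
  have hN := continuous_superposition hT.le hf v
  have huniq := uniqueDiffOn_Icc hT
  have hder : ∀ t ∈ Icc 0 T, derivWithin (primitiveFromRight hT.le v) (Icc 0 T) t
      = v (projIcc 0 T hT.le t) := fun t ht =>
    (hasDerivAt_primitiveFromRight hT.le v t).hasDerivWithinAt.derivWithin (huniq t ht)
  have hφv : EqOn (fun t => φ (derivWithin (primitiveFromRight hT.le v) (Icc 0 T) t))
      (fun t => ∫ τ in (0 : ℝ)..t, superposition hT.le f v τ) (Icc 0 T) := fun t ht => by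
    simp only [hder t ht, hv, φ.apply_symm_apply, projIcc_of_mem hT.le ht]
  have hW : ∀ t, HasDerivAt (fun t => ∫ τ in (0 : ℝ)..t, superposition hT.le f v τ)
      (superposition hT.le f v t) t := fun t => (hN.integral_hasStrictDerivAt 0 t).hasDerivAt
  refine ⟨?_, ?_, fun t ht => ?_, by simp [primitiveFromRight], ?_⟩
  · refine (contDiff_one_iff_deriv.2
      ⟨fun t => (hasDerivAt_primitiveFromRight hT.le v t).differentiableAt, ?_⟩).contDiffOn
    rw [funext fun t => (hasDerivAt_primitiveFromRight hT.le v t).deriv]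
    exact v.continuous.comp continuous_projIcc
  · refine ContDiffOn.congr (ContDiff.contDiffOn (contDiff_one_iff_deriv.2
      ⟨fun t => (hW t).differentiableAt, ?_⟩)) hφv
    rwa [funext fun t => (hW t).deriv]
  · rw [derivWithin_congr hφv (hφv ht), (hW t).hasDerivWithinAt.derivWithin (huniq t ht), hder t ht]
    simp only [superposition, projIcc_of_mem hT.le ht]
  · have h0 : (0 : ℝ) ∈ Icc 0 T := ⟨le_rfl, hT.le⟩
    rw [hder 0 h0, hv, projIcc_of_mem hT.le h0]
    simpa using φ.symm_apply_eq.2 hφ0.symm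

/-! ### Existence of a solution. -/

theorem theorem1 {X : Type*} [NormedAddCommGroup X] [NormedSpace ℝ X] [CompleteSpace X]
    (T : ℝ) (hT : 0 < T)
    (φ : X ≃ₜ X) (hφ0 : φ 0 = 0) (k : NNReal) (hφ : LipschitzWith k φ.symm)
    (f : ℝ → X → X → X)
    (hf : CompletelyContinuousOn (fun p : ℝ × X × X => f p.1 p.2.1 p.2.2) (Icc 0 T ×ˢ univ))
    (c₀ c₁ : ℝ) (hc₀ : 0 ≤ c₀) (hc₁ : 0 ≤ c₁)
    (hbound : ∀ t ∈ Icc 0 T, ∀ x y : X, ‖f t x y‖ ≤ c₀ + c₁ * ‖y‖) :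
    ∃ u : ℝ → X, IsBVPSolution T φ f u := by
  obtain ⟨G, hG, hGv⟩ := exists_integralOperator hT.le hf.1 φ.symm.continuous
  have hψ0 : φ.symm 0 = 0 := φ.symm_apply_eq.2 hφ0.symm
  obtain ⟨a, b, ha, hb, hab⟩ := exists_exp_supersolution k.coe_nonneg hc₀ hc₁ hT.le
  let D : Set C(Icc (0 : ℝ) T, X) := {v | ∀ t, ‖v t‖ ≤ a * Real.exp (b * t)}
  have hDconv : Convex ℝ D := by
    intro v hv w hw p q hp hq hpq t
    have := (convexOn_norm (convex_univ (𝕜 := ℝ) (E := X))).2 (mem_univ (v t)) (mem_univ (w t))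
      hp hq hpq
    refine this.trans ?_
    simp only [smul_eq_mul]
    calc p * ‖v t‖ + q * ‖w t‖ ≤ p * (a * Real.exp (b * t)) + q * (a * Real.exp (b * t)) := by
          gcongr
          exacts [hv t, hw t]
      _ = a * Real.exp (b * t) := by rw [← add_mul, hpq, one_mul]
  have hDclosed : IsClosed D := by
    simp only [D, ofPred_forall]
    exact isClosed_iInter fun t => isClosed_le (continuous_eval_const t).norm
      continuous_const
  have hDne : D.Nonempty := ⟨0, fun t => by simpa using by positivity⟩
  have hfv : ∀ v ∈ D, ∀ τ ∈ Icc 0 T,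
      ‖superposition hT.le f v τ‖ ≤ c₀ + c₁ * (a * Real.exp (b * τ)) := by
    intro v hv τ hτ
    refine (hbound _ (projIcc 0 T hT.le τ).2 _ _).trans ?_
    rw [projIcc_of_mem hT.le hτ]
    gcongr
    exact hv ⟨τ, hτ⟩
  have hDD : MapsTo G D D := by
    intro v hv t
    rw [hGv]
    have h1 := hφ.dist_le_mul (∫ τ in (0 : ℝ)..t, superposition hT.le f v τ) 0
    rw [hψ0, dist_zero_right, dist_zero_right] at h1
    refine h1.trans ((mul_le_mul_of_nonneg_left ?_ k.coe_nonneg).trans (hab t t.2))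
    refine intervalIntegral.norm_integral_le_of_norm_le t.2.1
      (Filter.Eventually.of_forall fun τ hτ => hfv v hv τ ⟨hτ.1.le, hτ.2.trans t.2.2⟩)
      (Continuous.intervalIntegrable (by fun_prop) _ _)
  set M := a * Real.exp (b * T) with hM
  have hM0 : 0 ≤ M := by positivity
  have hDM : ∀ v ∈ D, ∀ t, ‖v t‖ ≤ M := fun v hv t => (hv t).trans (by
    have := t.2.2
    rw [hM]
    gcongr)
  let B : Set (ℝ × X × X) :=
    Icc 0 T ×ˢ Metric.closedBall (0 : X) (M * T) ×ˢ Metric.closedBall (0 : X) M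
  -- B contains every (t, u t, v t) with v in D, so compactness of f on bounded sets gives one
  -- compact set for all integrands.
  have hQ := hf.2 B (fun p hp => ⟨hp.1, mem_univ _⟩)
    ((Metric.isBounded_Icc 0 T).prod (Metric.isBounded_closedBall.prod Metric.isBounded_closedBall))
  obtain ⟨S, hS, hSint⟩ := exists_isCompact_forall_integral_mem hQ T
  obtain ⟨A, hA, hAmem⟩ := exists_isCompact_superset_lipschitz (α := Icc (0 : ℝ) T)
    (hS.image φ.symm.continuous) (k * (c₀ + c₁ * M).toNNReal)
  have hDA : MapsTo G D A := by
    intro v hv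
    have hN := continuous_superposition hT.le hf.1 v
    refine hAmem _ (fun t => ?_) (LipschitzWith.of_dist_le_mul fun s t => ?_)
    · rw [hGv]
      refine mem_image_of_mem _ (hSint _ hN (fun τ => subset_closure ⟨(_, _, _), ⟨?_, ?_, ?_⟩, rfl⟩)
        t t.2)
      · exact (projIcc 0 T hT.le τ).2
      · exact mem_closedBall_zero_iff.2
          (norm_primitiveFromRight_le hT.le (hDM v hv) (projIcc 0 T hT.le τ).2)
      · exact mem_closedBall_zero_iff.2 (hDM v hv _)
    · rw [hGv, hGv, NNReal.coe_mul, mul_assoc, Real.coe_toNNReal _ (by positivity)]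
      refine (hφ.dist_le_mul _ _).trans (mul_le_mul_of_nonneg_left ?_ k.coe_nonneg)
      rw [dist_eq_norm, intervalIntegral.integral_interval_sub_left (hN.intervalIntegrable _ _)
        (hN.intervalIntegrable _ _), Subtype.dist_eq, Real.dist_eq]
      refine intervalIntegral.norm_integral_le_of_norm_le_const fun τ _ => ?_
      refine (hbound _ (projIcc 0 T hT.le τ).2 _ _).trans ?_
      gcongr
      exact hDM v hv _
  obtain ⟨v, -, hv⟩ := exists_fixedPoint_of_mapsTo_compact hDconv hDclosed hDne hA hG.continuousOn
    hDD hDA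
  exact ⟨_, isBVPSolution_primitiveFromRight hT hφ0 hf.1 fun t => by rw [← hGv, hv]⟩
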